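/- **Setting.** A rooted tree is a (non-empty) finite non-planar rooted tree up to isomorphism; $V(t)$ is its vertex set, $\bullet$ is the one-vertex tree, and $B_+(t_1\cdots t_n)$ is the tree obtained by joining the roots of $t_1,\dots,t_n$ to a new root. For rooted trees $t,t'$ let $N_t(t')$ be the formal sum, over the vertices $v$ of $t'$, of the trees obtained from $t'$ by adding an edge from $v$ to the root of $t$. A family of operators indexed by rooted trees is extended linearly to formal linear combinations of trees. Let $U\subseteq\mathbb R$ be open (a coordinate patch of a one-dimensional manifold), with coordinate $x$, and let $(x,z)\in U\times\mathbb R$ be the coordinates $y=e^z$ on its bundle $F^+U$ of positively oriented frames. Let $\Gamma$ be a smooth function of $x\in U$. Put $\phi^x(\bullet)=e^z$, $\phi^z(\bullet)=-e^z\Gamma(x)$, and for $t=B_+(t_1\cdots t_n)$ $$\phi_t(h)=\sum_{i_1,\dots,i_n\in\{x,z\}}\phi^{i_1}(t_1)\cdots\phi^{i_n}(t_n)\,\partial_{i_1}\cdots\partial_{i_n}h,\qquad \phi^i(t)=\phi_t(\phi^i(\bullet)).$$ For an orientation preserving local diffeomorphism $\psi$ of $U$ (a diffeomorphism with positive derivative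 between open subsets of $U$), let $\tilde\psi(x,z)=(\psi(x),z+\log\psi'(x))$, and let $$\gamma_\bullet(\psi)=\phi^x(\bullet)\,\partial_x(z\circ\tilde\psi)+\phi^z(\bullet)\,\partial_z(z\circ\tilde\psi)-\phi^z(\bullet)\circ\tilde\psi,\qquad \gamma_t(\psi)=\phi_t(\gamma_\bullet(\psi)),$$ smooth functions on $\mathrm{Dom}\,\tilde\psi=\mathrm{Dom}\,\psi\times\mathbb R$. Let $\mathcal A=C_c^\infty(F^+U)\rtimes\mathrm{Diff}^+(U)$ be the space of finite sums of monomials $fU_\psi^*$ with $f\in C_c^\infty(\mathrm{Dom}\,\tilde\psi)$, that is, $\mathcal A=\bigoplus_\psi C_c^\infty(\mathrm{Dom}\,\tilde\psi)\,U_\psi^*$. For each rooted tree $t$ define linear operators on $\mathcal A$ by $$Y(fU_\psi^*)=(\partial_zf)U_\psi^*,\quad X_t(fU_\psi^*)=\bigl(\phi^x(t)\partial_xf+\phi^z(t)\partial_zf\bigr)U_\psi^*,\quad \delta_t(fU_\psi^*)=\gamma_t(\psi)fU_\psi^*,\quad \phi_t(fU_\psi^*)=\phi_t(f)U_\psi^*,$$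 and let $\mathcal L(1)$ be the Lie algebra of operators on $\mathcal A$ (with the commutator as bracket) generated by $Y$, all $X_t$ and all $\delta_t$. **Theorem.** For all rooted trees $t,t'$ the following relations hold in $\mathcal L(1)$: $$[Y,X_t]=|V(t)|\,X_t,\qquad [X_t,\delta_{t'}]=\delta_{N_t(t')},\qquad [Y,\delta_t]=|V(t)|\,\delta_t,\qquad[\delta_t,\delta_{t'}]=0,$$ $$[X_t,X_{t'}]=X_{N_t(t')}-X_{N_{t'}(t)}=\phi_{N_t(B_+(t'))}-\phi_{N_{t'}(B_+(t))}.$$ -/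

import Mathlib

open scoped ContDiff DirectSum
open TopologicalSpace (Opens)

noncomputable section

namespace ConnesMoscovici

/-! ### Non-planar rooted trees -/

/-- Finite multisets form a quotient of the polynomial functor `α ↦ Σ n, (Fin n → α)`. -/
instance multisetQPF : QPF Multiset.{0} where
  P := ⟨ℕ, Fin⟩
  abs p := (List.ofFn p.2 : Multiset _)
  repr s := ⟨s.toList.length, fun i => s.toList.get i⟩
  abs_repr s := (congrArg _ (List.ofFn_get s.toList)).trans (Multiset.coe_toList s)
  abs_map f p := by
    obtain ⟨n, g⟩ := p
    exact congrArg Multiset.ofList (List.map_ofFn (f := g) (g := f)).symm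

/-- (Isomorphism classes of) finite non-planar rooted trees: the inductive type whose only
constructor builds a tree from the finite multiset of the branches at its root. -/
def RTree : Type := QPF.Fix Multiset

namespace RTree

/-- The grafting operator `B₊`: the roots of the trees of a forest are joined to a new root. -/
def graft (s : Multiset RTree) : RTree := QPF.Fix.mk s

/-- The branches at the root: the forest `s` with `t = B₊(s)`. -/
def branches (t : RTree) : Multiset RTree := QPF.Fix.dest t

/-- Structural recursion: `fold g (B₊ s) = g (s.map (fold g))`. -/
def fold {α : Type} (g : Multiset α → α) : RTree → α := QPF.Fix.rec g

theorem fold_graft {α : Type} (g : Multiset α → α) (s : Multiset RTree) :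
    fold g (graft s) = g (s.map (fold g)) := QPF.Fix.rec_eq g s

theorem graft_branches (t : RTree) : graft (branches t) = t := QPF.Fix.mk_dest t

theorem branches_graft (s : Multiset RTree) : branches (graft s) = s := QPF.Fix.dest_mk s

theorem induction {p : RTree → Prop} (h : ∀ s : Multiset RTree, (∀ t ∈ s, p t) → p (graft s))
    (t : RTree) : p t := by
  refine QPF.Fix.ind p (fun s hs => h s ?_) t
  obtain ⟨u, rfl⟩ := hs
  intro t ht
  obtain ⟨a, -, rfl⟩ := Multiset.mem_map.1 ht
  exact a.2

/-- The number `|V(t)|` of vertices. -/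
def numVerts : RTree → ℕ := fold fun s => s.sum + 1

open Classical in
/-- `growAux t t'` is `t'` itself, together with the multiset of the trees obtained from `t'`, one
for each vertex `v` of `t'`, by adding an edge from `v` to the root of `t`: either `v` is the root
of `t'`, or `v` is a vertex of one of the branches `c` at the root. -/
def growAux (t : RTree) : RTree → RTree × Multiset RTree :=
  fold fun s => (graft (s.map Prod.fst),
    graft (t ::ₘ s.map Prod.fst) ::ₘ
      s.bind fun c => c.2.map fun u => graft (u ::ₘ (s.erase c).map Prod.fst))

/-- Natural growth `N_t(t')` of a tree `t'` by a tree `t`: the formal sum, over the vertices `v` of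
`t'`, of the trees obtained by adding an edge from `v` to the root of `t`. -/
def grow (t t' : RTree) : RTree →₀ ℚ :=
  ((growAux t t').2.map fun u => Finsupp.single u 1).sum

end RTree

/-- The extension of a family indexed by rooted trees to formal linear combinations of trees. -/
def linExt {V : Type*} [AddCommGroup V] [Module ℝ V] (F : RTree → V) (v : RTree →₀ ℚ) : V :=
  v.sum fun u c => (c : ℝ) • F u

/-! ### Functions of the coordinates `(x, z)` -/

/-- `∂ₓ` -/
def pdx (h : ℝ × ℝ → ℝ) : ℝ × ℝ → ℝ := fun p => fderiv ℝ h p (1, 0)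

/-- `∂_z` -/
def pdz (h : ℝ × ℝ → ℝ) : ℝ × ℝ → ℝ := fun p => fderiv ℝ h p (0, 1)

/-- For a multiset `s = {a₁, …, aₙ}` of pairs `aⱼ = (aⱼˣ, aⱼᶻ)` of functions, the function
`∑ a₁^{i₁} ⋯ aₙ^{iₙ} ∂_{i₁} ⋯ ∂_{iₙ} h`, the sum being over all `(i₁, …, iₙ) ∈ {x, z}ⁿ`. Such a
sequence of indices is a splitting of `s` into the part with index `x` and the part with
index `z`. -/
def contract (s : Multiset ((ℝ × ℝ → ℝ) × (ℝ × ℝ → ℝ))) (h : ℝ × ℝ → ℝ) : ℝ × ℝ → ℝ :=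
  (s.antidiagonal.map fun q =>
    (q.1.map Prod.fst).prod * (q.2.map Prod.snd).prod *
      (pdx^[Multiset.card q.1] (pdz^[Multiset.card q.2] h))).sum

/-- A smooth function `Γ` of the coordinate `x ∈ U` (the analogue of the Christoffel symbol). -/
structure Christoffel (U : Opens ℝ) where
  toFun : ℝ → ℝ
  contDiffOn : ContDiffOn ℝ ∞ toFun U

variable {U : Opens ℝ}

/-- The right-hand side `(φˣ(•), φᶻ(•)) = (e^z, -e^z Γ(x))` of the system of differential
equations. -/
def phiBullet (Γ : Christoffel U) : (ℝ × ℝ → ℝ) × (ℝ × ℝ → ℝ) :=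
  (fun p => Real.exp p.2, fun p => -(Real.exp p.2 * Γ.toFun p.1))

/-- The pair of functions `(φˣ(t), φᶻ(t))`: for `t = B₊(t₁ ⋯ tₙ)`,
`φⁱ(t) = ∑ φ^{i₁}(t₁) ⋯ φ^{iₙ}(tₙ) ∂_{i₁} ⋯ ∂_{iₙ} φⁱ(•)`. -/
def phi (Γ : Christoffel U) : RTree → (ℝ × ℝ → ℝ) × (ℝ × ℝ → ℝ) :=
  RTree.fold fun s => (contract s (phiBullet Γ).1, contract s (phiBullet Γ).2)

/-- The operator `φ_t`: for `t = B₊(t₁ ⋯ tₙ)`,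
`φ_t(h) = ∑ φ^{i₁}(t₁) ⋯ φ^{iₙ}(tₙ) ∂_{i₁} ⋯ ∂_{iₙ} h`. -/
def phiOp (Γ : Christoffel U) (t : RTree) (h : ℝ × ℝ → ℝ) : ℝ × ℝ → ℝ :=
  contract (t.branches.map (phi Γ)) h

/-! ### Local diffeomorphisms -/

/-- Orientation preserving local diffeomorphisms of `U`: diffeomorphisms from an open subset `dom`
of `U` onto an (automatically open) subset of `U`, with positive derivative (so the inverse is
automatically smooth). The map is extended by the identity outside `dom`, so that there is exactly
one term for each local diffeomorphism. -/
@[ext]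
structure LocDiff (U : Opens ℝ) where
  dom : Opens ℝ
  toFun : ℝ → ℝ
  dom_le : dom ≤ U
  mapsTo : Set.MapsTo toFun dom U
  injOn : Set.InjOn toFun dom
  contDiffOn : ContDiffOn ℝ ∞ toFun dom
  deriv_pos : ∀ x ∈ dom, 0 < deriv toFun x
  off_dom : ∀ x ∉ dom, toFun x = x

/-- The part of the frame bundle above `W ⊆ ℝ`, in the coordinates `(x, z)`, `y = e^z`. -/
def frames (W : Opens ℝ) : Opens (ℝ × ℝ) := W.comap ⟨Prod.fst, continuous_fst⟩

/-- The lift `ψ̃` of `ψ` to frames, `(x, y) ↦ (ψ(x), y ψ'(x))`, in the coordinates `(x, z)`. -/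
def LocDiff.lift (ψ : LocDiff U) (p : ℝ × ℝ) : ℝ × ℝ :=
  (ψ.toFun p.1, p.2 + Real.log (deriv ψ.toFun p.1))

/-- The function `γ_•(ψ)` with `γ_•(ψ) Y = ψ̃_* X_• - X_•`: at a point `p` it is the difference, in
the `z`-direction, between the push-forward of `X_•` from `p` to `ψ̃(p)` and `X_•` at `ψ̃(p)`, that is
`X_•(z ∘ ψ̃)(p) - φᶻ(•)(ψ̃(p))`. -/
def gammaBullet (Γ : Christoffel U) (ψ : LocDiff U) : ℝ × ℝ → ℝ := fun p =>
  (phiBullet Γ).1 p * pdx (fun q => (ψ.lift q).2) p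
    + (phiBullet Γ).2 p * pdz (fun q => (ψ.lift q).2) p
    - (phiBullet Γ).2 (ψ.lift p)

/-- `γ_t(ψ) = φ_t(γ_•(ψ))` -/
def gamma (Γ : Christoffel U) (t : RTree) (ψ : LocDiff U) : ℝ × ℝ → ℝ :=
  phiOp Γ t (gammaBullet Γ ψ)

/-! ### Smoothness of these functions -/

section Smoothness

variable {W : Opens (ℝ × ℝ)} {h : ℝ × ℝ → ℝ}

theorem smooth_pd (hh : ContDiffOn ℝ ∞ h W) (v : ℝ × ℝ) :
    ContDiffOn ℝ ∞ (fun p => fderiv ℝ h p v) W :=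
  (hh.fderiv_of_isOpen W.isOpen (by simp)).clm_apply contDiffOn_const

theorem smooth_iter (hh : ContDiffOn ℝ ∞ h W) (a b : ℕ) :
    ContDiffOn ℝ ∞ (pdx^[a] (pdz^[b] h)) W := by
  have h1 : ∀ b, ContDiffOn ℝ ∞ (pdz^[b] h) W := fun b => by
    induction b with
    | zero => exact hh
    | succ b ih => rw [Function.iterate_succ_apply']; exact smooth_pd ih _
  induction a with
  | zero => exact h1 b
  | succ a ih => rw [Function.iterate_succ_apply']; exact smooth_pd ih _

theorem smooth_prod (s : Multiset (ℝ × ℝ → ℝ)) (hs : ∀ g ∈ s, ContDiffOn ℝ ∞ g W) :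
    ContDiffOn ℝ ∞ s.prod W := by
  induction s using Multiset.induction with
  | empty => exact contDiffOn_const
  | cons a s ih =>
    rw [Multiset.prod_cons]
    exact (hs a (Multiset.mem_cons_self a s)).mul
      (ih fun g hg => hs g (Multiset.mem_cons_of_mem hg))

theorem smooth_sum (s : Multiset (ℝ × ℝ → ℝ)) (hs : ∀ g ∈ s, ContDiffOn ℝ ∞ g W) :
    ContDiffOn ℝ ∞ s.sum W := by
  induction s using Multiset.induction with
  | empty => exact contDiffOn_const
  | cons a s ih =>
    rw [Multiset.sum_cons]
    exact (hs a (Multiset.mem_cons_self a s)).add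
      (ih fun g hg => hs g (Multiset.mem_cons_of_mem hg))

theorem smooth_contract {s : Multiset ((ℝ × ℝ → ℝ) × (ℝ × ℝ → ℝ))}
    (hs : ∀ a ∈ s, ContDiffOn ℝ ∞ a.1 W ∧ ContDiffOn ℝ ∞ a.2 W) (hh : ContDiffOn ℝ ∞ h W) :
    ContDiffOn ℝ ∞ (contract s h) W := by
  refine smooth_sum _ fun g hg => ?_
  obtain ⟨q, hq, rfl⟩ := Multiset.mem_map.1 hg
  have hq' := Multiset.mem_antidiagonal.1 hq
  refine ((smooth_prod _ ?_).mul (smooth_prod _ ?_)).mul (smooth_iter hh _ _)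
  · intro g hg
    obtain ⟨a, ha, rfl⟩ := Multiset.mem_map.1 hg
    exact (hs a (hq' ▸ Multiset.mem_add.2 (Or.inl ha))).1
  · intro g hg
    obtain ⟨a, ha, rfl⟩ := Multiset.mem_map.1 hg
    exact (hs a (hq' ▸ Multiset.mem_add.2 (Or.inr ha))).2

theorem smooth_phiBullet (Γ : Christoffel U) :
    ContDiffOn ℝ ∞ (phiBullet Γ).1 (frames U) ∧ ContDiffOn ℝ ∞ (phiBullet Γ).2 (frames U) := by
  have h1 : ContDiffOn ℝ ∞ (fun p : ℝ × ℝ => Real.exp p.2) (frames U) :=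
    (Real.contDiff_exp.comp contDiff_snd).contDiffOn
  exact ⟨h1, (h1.mul (Γ.contDiffOn.comp contDiff_fst.contDiffOn fun p hp => hp)).neg⟩

theorem smooth_phi (Γ : Christoffel U) (t : RTree) :
    ContDiffOn ℝ ∞ (phi Γ t).1 (frames U) ∧ ContDiffOn ℝ ∞ (phi Γ t).2 (frames U) := by
  induction t using RTree.induction with
  | h s ih =>
    have hs : ∀ a ∈ s.map (phi Γ),
        ContDiffOn ℝ ∞ a.1 (frames U) ∧ ContDiffOn ℝ ∞ a.2 (frames U) := by
      intro a ha
      obtain ⟨t, ht, rfl⟩ := Multiset.mem_map.1 ha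
      exact ih t ht
    have key : phi Γ (RTree.graft s) =
        (contract (s.map (phi Γ)) (phiBullet Γ).1, contract (s.map (phi Γ)) (phiBullet Γ).2) :=
      RTree.fold_graft _ s
    rw [key]
    exact ⟨smooth_contract hs (smooth_phiBullet Γ).1, smooth_contract hs (smooth_phiBullet Γ).2⟩

theorem frames_mono {V W : Opens ℝ} (hVW : V ≤ W) : (frames V : Set (ℝ × ℝ)) ⊆ frames W :=
  fun _ hp => hVW hp

theorem smooth_phiOp (Γ : Christoffel U) (t : RTree) (hW : (W : Set (ℝ × ℝ)) ⊆ frames U)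
    (hh : ContDiffOn ℝ ∞ h W) : ContDiffOn ℝ ∞ (phiOp Γ t h) W := by
  refine smooth_contract (fun a ha => ?_) hh
  obtain ⟨u, -, rfl⟩ := Multiset.mem_map.1 ha
  exact ⟨(smooth_phi Γ u).1.mono hW, (smooth_phi Γ u).2.mono hW⟩

theorem smooth_gammaBullet (Γ : Christoffel U) (ψ : LocDiff U) :
    ContDiffOn ℝ ∞ (gammaBullet Γ ψ) (frames ψ.dom) := by
  have hsub := frames_mono ψ.dom_le
  have hfst : ContDiffOn ℝ ∞ (Prod.fst : ℝ × ℝ → ℝ) (frames ψ.dom) := contDiff_fst.contDiffOn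
  have hd : ContDiffOn ℝ ∞ (deriv ψ.toFun) ψ.dom :=
    ψ.contDiffOn.deriv_of_isOpen ψ.dom.isOpen (by simp)
  have hl : ContDiffOn ℝ ∞ (fun q => (ψ.lift q).2) (frames ψ.dom) :=
    contDiff_snd.contDiffOn.add
      ((hd.log fun x hx => (ψ.deriv_pos x hx).ne').comp hfst fun p hp => hp)
  have hl1 : ContDiffOn ℝ ∞ (fun q => (ψ.lift q).1) (frames ψ.dom) :=
    ψ.contDiffOn.comp hfst fun p hp => hp
  have hb := smooth_phiBullet Γ
  exact (((hb.1.mono hsub).mul (smooth_pd hl _)).add ((hb.2.mono hsub).mul (smooth_pd hl _))).sub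
    (hb.2.comp (hl1.prodMk hl) fun p hp => ψ.mapsTo hp)

theorem smooth_gamma (Γ : Christoffel U) (t : RTree) (ψ : LocDiff U) :
    ContDiffOn ℝ ∞ (gamma Γ t ψ) (frames ψ.dom) :=
  smooth_phiOp Γ t (frames_mono ψ.dom_le) (smooth_gammaBullet Γ ψ)

end Smoothness

/-! ### Operators on compactly supported smooth functions -/

/-- `C_c^∞(W)` -/
abbrev Cc (W : Opens (ℝ × ℝ)) : Type := TestFunction W ℝ ⊤

section Operators

variable {W : Opens (ℝ × ℝ)}

/-- A function that is smooth on `W` and vanishes off the support of some `f ∈ C_c^∞(W)` lies in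
`C_c^∞(W)`. -/
def Cc.mk' (f : Cc W) (g : ℝ × ℝ → ℝ) (hg : ContDiffOn ℝ ∞ g W)
    (h0 : ∀ p ∉ tsupport f, g p = 0) : Cc W where
  toFun := g
  contDiff' := by
    rw [contDiff_iff_contDiffAt]
    intro p
    by_cases hp : p ∈ tsupport f
    · exact hg.contDiffAt (W.isOpen.mem_nhds (f.tsupport_subset hp))
    · have : g =ᶠ[nhds p] fun _ => 0 := by
        filter_upwards [(isClosed_tsupport f).isOpen_compl.mem_nhds hp] with q hq using h0 q hq
      exact contDiffAt_const.congr_of_eventuallyEq this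
  hasCompactSupport' := HasCompactSupport.intro f.hasCompactSupport h0
  tsupport_subset' := (closure_minimal (fun p hp => by_contra fun hc => hp (h0 p hc) : Function.support g ⊆ tsupport f)
    (isClosed_tsupport f)).trans f.tsupport_subset

theorem Cc.smoothOn (f : Cc W) : ContDiffOn ℝ ∞ f W := f.contDiff.contDiffOn

theorem pd_eq_zero {g : ℝ × ℝ → ℝ} {K : Set (ℝ × ℝ)} (hK : IsClosed K) (hg : ∀ p ∉ K, g p = 0)
    (v : ℝ × ℝ) (p : ℝ × ℝ) (hp : p ∉ K) : fderiv ℝ g p v = 0 := by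
  have : g =ᶠ[nhds p] fun _ => 0 := by
    filter_upwards [hK.isOpen_compl.mem_nhds hp] with q hq using hg q hq
  rw [this.fderiv_eq]
  simp

theorem iter_eq_zero {g : ℝ × ℝ → ℝ} {K : Set (ℝ × ℝ)} (hK : IsClosed K) (hg : ∀ p ∉ K, g p = 0)
    (a b : ℕ) : ∀ p ∉ K, (pdx^[a] (pdz^[b] g)) p = 0 := by
  have h1 : ∀ b, ∀ p ∉ K, (pdz^[b] g) p = 0 := fun b => by
    induction b with
    | zero => exact hg
    | succ b ih => rw [Function.iterate_succ_apply']; exact pd_eq_zero hK ih _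
  induction a with
  | zero => exact h1 b
  | succ a ih => rw [Function.iterate_succ_apply']; exact pd_eq_zero hK ih _

theorem multiset_sum_apply (s : Multiset (ℝ × ℝ → ℝ)) (p : ℝ × ℝ) :
    s.sum p = (s.map fun g => g p).sum :=
  map_multiset_sum (Pi.evalAddMonoidHom (fun _ : ℝ × ℝ => ℝ) p) s

theorem contract_apply (s : Multiset ((ℝ × ℝ → ℝ) × (ℝ × ℝ → ℝ))) (h : ℝ × ℝ → ℝ) (p : ℝ × ℝ) :
    contract s h p = (s.antidiagonal.map fun q =>
      ((q.1.map Prod.fst).prod * (q.2.map Prod.snd).prod) p *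
        (pdx^[Multiset.card q.1] (pdz^[Multiset.card q.2] h)) p).sum := by
  rw [contract, multiset_sum_apply, Multiset.map_map]
  rfl

theorem contract_eq_zero (s : Multiset ((ℝ × ℝ → ℝ) × (ℝ × ℝ → ℝ))) (f : Cc W) :
    ∀ p ∉ tsupport f, contract s f p = 0 := by
  intro p hp
  rw [contract_apply]
  refine Multiset.sum_eq_zero fun c hc => ?_
  obtain ⟨q, -, rfl⟩ := Multiset.mem_map.1 hc
  rw [iter_eq_zero (isClosed_tsupport f) (fun p hp => image_eq_zero_of_notMem_tsupport hp) _ _ p hp,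
    mul_zero]

theorem pd_add {f g : ℝ × ℝ → ℝ} (hf : ContDiff ℝ ∞ f) (hg : ContDiff ℝ ∞ g) (v : ℝ × ℝ) :
    (fun p => fderiv ℝ (f + g) p v) = (fun p => fderiv ℝ f p v) + fun p => fderiv ℝ g p v := by
  funext p
  rw [fderiv_add (hf.differentiable (by simp) p) (hg.differentiable (by simp) p)]
  rfl

theorem pd_smul (c : ℝ) (f : ℝ × ℝ → ℝ) (v : ℝ × ℝ) :
    (fun p => fderiv ℝ (c • f) p v) = c • fun p => fderiv ℝ f p v := by
  funext p
  rw [fderiv_const_smul_field]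
  rfl

theorem iter_smooth {f : ℝ × ℝ → ℝ} (hf : ContDiff ℝ ∞ f) (a b : ℕ) :
    ContDiff ℝ ∞ (pdx^[a] (pdz^[b] f)) := by
  have := smooth_iter (W := ⊤) (h := f) hf.contDiffOn a b
  simpa [contDiffOn_univ] using this

theorem iter_add {f g : ℝ × ℝ → ℝ} (hf : ContDiff ℝ ∞ f) (hg : ContDiff ℝ ∞ g) (a b : ℕ) :
    pdx^[a] (pdz^[b] (f + g)) = pdx^[a] (pdz^[b] f) + pdx^[a] (pdz^[b] g) := by
  have h1 : ∀ b, pdz^[b] (f + g) = pdz^[b] f + pdz^[b] g := fun b => by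
    induction b with
    | zero => rfl
    | succ b ih =>
      simp only [Function.iterate_succ_apply', ih]
      exact pd_add (iter_smooth hf 0 b) (iter_smooth hg 0 b) _
  induction a with
  | zero => exact h1 b
  | succ a ih =>
    simp only [Function.iterate_succ_apply', ih]
    exact pd_add (iter_smooth hf a b) (iter_smooth hg a b) _

theorem iter_smul (c : ℝ) (f : ℝ × ℝ → ℝ) (a b : ℕ) :
    pdx^[a] (pdz^[b] (c • f)) = c • pdx^[a] (pdz^[b] f) := by
  have h1 : ∀ b, pdz^[b] (c • f) = c • pdz^[b] f := fun b => by
    induction b with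
    | zero => rfl
    | succ b ih => simp only [Function.iterate_succ_apply', ih]; exact pd_smul c _ _
  induction a with
  | zero => exact h1 b
  | succ a ih => simp only [Function.iterate_succ_apply', ih]; exact pd_smul c _ _

theorem contract_add (s : Multiset ((ℝ × ℝ → ℝ) × (ℝ × ℝ → ℝ))) {f g : ℝ × ℝ → ℝ}
    (hf : ContDiff ℝ ∞ f) (hg : ContDiff ℝ ∞ g) :
    contract s (f + g) = contract s f + contract s g := by
  simp only [contract, iter_add hf hg, mul_add, Multiset.sum_map_add]

theorem contract_smul (s : Multiset ((ℝ × ℝ → ℝ) × (ℝ × ℝ → ℝ))) (c : ℝ) (f : ℝ × ℝ → ℝ) :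
    contract s (c • f) = c • contract s f := by
  simp only [contract, iter_smul, mul_smul_comm, Multiset.smul_sum, Multiset.map_map,
    Function.comp_def]

/-- Multiplication by a function that is smooth on `W`, on `C_c^∞(W)`. -/
def mulCc (g : ℝ × ℝ → ℝ) (hg : ContDiffOn ℝ ∞ g W) : Module.End ℝ (Cc W) where
  toFun f := Cc.mk' f (g * f) (hg.mul f.smoothOn) fun p hp => by
    simp [image_eq_zero_of_notMem_tsupport hp]
  map_add' f f' := DFunLike.coe_injective (mul_add g (f : ℝ × ℝ → ℝ) f')
  map_smul' c f := DFunLike.coe_injective (mul_smul_comm c g (f : ℝ × ℝ → ℝ))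

/-- `∂ₓ` on `C_c^∞(W)` -/
def dxCc : Module.End ℝ (Cc W) where
  toFun f := Cc.mk' f (pdx f) (smooth_pd f.smoothOn _)
    (pd_eq_zero (isClosed_tsupport f) (fun _ hp => image_eq_zero_of_notMem_tsupport hp) _)
  map_add' f f' := DFunLike.coe_injective (pd_add f.contDiff f'.contDiff _)
  map_smul' c f := DFunLike.coe_injective (pd_smul c f _)

/-- `∂_z` on `C_c^∞(W)` -/
def dzCc : Module.End ℝ (Cc W) where
  toFun f := Cc.mk' f (pdz f) (smooth_pd f.smoothOn _)
    (pd_eq_zero (isClosed_tsupport f) (fun _ hp => image_eq_zero_of_notMem_tsupport hp) _)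
  map_add' f f' := DFunLike.coe_injective (pd_add f.contDiff f'.contDiff _)
  map_smul' c f := DFunLike.coe_injective (pd_smul c f _)

/-- The operator `φ_t` on `C_c^∞(W)`, for `W` contained in the frame bundle of `U`. -/
def phiCc (Γ : Christoffel U) (t : RTree) (hW : (W : Set (ℝ × ℝ)) ⊆ frames U) :
    Module.End ℝ (Cc W) where
  toFun f := Cc.mk' f (phiOp Γ t f) (smooth_phiOp Γ t hW f.smoothOn) (contract_eq_zero _ f)
  map_add' f f' := DFunLike.coe_injective (contract_add _ f.contDiff f'.contDiff)
  map_smul' c f := DFunLike.coe_injective (contract_smul _ c f)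

end Operators

/-! ### The operators `Y`, `X_t`, `δ_t` and the Lie algebra that they span -/

/-- The crossed product `C_c^∞(F⁺U) ⋊ Diff⁺(U)`: finite sums of monomials `f U_ψ^*`, with `ψ` an
orientation preserving local diffeomorphism of `U` and `f ∈ C_c^∞(Dom ψ̃)`. -/
def CrossedProduct (U : Opens ℝ) : Type := ⨁ ψ : LocDiff U, Cc (frames ψ.dom)

instance (U : Opens ℝ) : AddCommGroup (CrossedProduct U) :=
  inferInstanceAs (AddCommGroup (⨁ ψ : LocDiff U, Cc (frames ψ.dom)))

instance (U : Opens ℝ) : Module ℝ (CrossedProduct U) :=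
  inferInstanceAs (Module ℝ (⨁ ψ : LocDiff U, Cc (frames ψ.dom)))

/-- Linear operators on the crossed product form a Lie algebra with the commutator as bracket. -/
instance (U : Opens ℝ) : LieRing (Module.End ℝ (CrossedProduct U)) := LieRing.ofAssociativeRing

/-- The operator `Y`: `f U_ψ^* ↦ (∂_z f) U_ψ^*`. -/
def opY (U : Opens ℝ) : Module.End ℝ (CrossedProduct U) :=
  DirectSum.lmap fun _ => dzCc

/-- The vector field `X_t = φˣ(t) ∂ₓ + φᶻ(t) ∂_z`, acting by `f U_ψ^* ↦ (X_t f) U_ψ^*`. -/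
def opX (Γ : Christoffel U) (t : RTree) : Module.End ℝ (CrossedProduct U) :=
  DirectSum.lmap fun ψ =>
    mulCc (phi Γ t).1 ((smooth_phi Γ t).1.mono (frames_mono ψ.dom_le)) * dxCc +
      mulCc (phi Γ t).2 ((smooth_phi Γ t).2.mono (frames_mono ψ.dom_le)) * dzCc

/-- The operator `δ_t`: `f U_ψ^* ↦ γ_t(ψ) f U_ψ^*`. -/
def opDelta (Γ : Christoffel U) (t : RTree) : Module.End ℝ (CrossedProduct U) :=
  DirectSum.lmap fun ψ => mulCc (gamma Γ t ψ) (smooth_gamma Γ t ψ)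

/-- The operator `φ_t`, acting by `f U_ψ^* ↦ φ_t(f) U_ψ^*`. -/
def opPhi (Γ : Christoffel U) (t : RTree) : Module.End ℝ (CrossedProduct U) :=
  DirectSum.lmap fun ψ => phiCc Γ t (frames_mono ψ.dom_le)

/-- The Lie algebra `L(1)` spanned by `Y`, the `X_t` and the `δ_t`: the smallest Lie algebra of
operators on the crossed product, with the commutator as bracket, that contains them. -/
def L1 (Γ : Christoffel U) : LieSubalgebra ℝ (Module.End ℝ (CrossedProduct U)) :=
  LieSubalgebra.lieSpan ℝ _ ({opY U} ∪ Set.range (opX Γ) ∪ Set.range (opDelta Γ))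

namespace L1

/-- `Y` as an element of `L(1)` -/
def Y (Γ : Christoffel U) : L1 Γ :=
  ⟨opY U, LieSubalgebra.subset_lieSpan (Or.inl (Or.inl rfl))⟩

/-- `X_t` as an element of `L(1)` -/
def X (Γ : Christoffel U) (t : RTree) : L1 Γ :=
  ⟨opX Γ t, LieSubalgebra.subset_lieSpan (Or.inl (Or.inr ⟨t, rfl⟩))⟩

/-- `δ_t` as an element of `L(1)` -/
def δ (Γ : Christoffel U) (t : RTree) : L1 Γ :=
  ⟨opDelta Γ t, LieSubalgebra.subset_lieSpan (Or.inr ⟨t, rfl⟩)⟩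

end L1

end ConnesMoscovici

end

open ConnesMoscovici

namespace ConnesMoscovici

/-! All operators act diagonally on the monomials `f U_ψ^*`, so every relation is an identity
between differential operators on `C_c^∞(Dom ψ̃)`, to be checked pointwise on the open set where the
coefficients are smooth.

The core is that `X_t` sends `φ_{t'}(h)` to `φ_{N_t(t')}(h)` (`fderiv_phiOp_phi`). For `t' = B₊(t₁ ⋯
tₙ)`, the Leibniz rule `fderiv_contract` either differentiates `h` once more, which attaches `t` to
the root, or differentiates a coefficient `φⁱ(tⱼ) = φ_{tⱼ}(φⁱ(•))`, which by induction attaches `t`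
to the vertices of `tⱼ`. With `h = γ_•(ψ)` this gives `[X_t, δ_{t'}]`; with `h = φⁱ(•)` it gives the
coefficients of `[X_t, X_{t'}]`, since the second-order terms of a commutator of vector fields
cancel.

The brackets with `Y` express homogeneity: `φⁱ(•)` and `γ_•(ψ)` have the form `e^z A(x)`, so each
vertex contributes one factor `e^z` and `∂_z` multiplies by the number of vertices (`pdz_phiOp`).

Finally, `N_t(B₊(t')) = B₊(t t') + B₊(N_t(t'))` and `φ_{B₊(u)} = X_u`; the term `B₊(t t')` is
symmetric and drops out of the difference. -/

open Multiset in
/-- Sums over the ways of choosing an element of a multiset, with the remaining elements. -/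
theorem sum_map_erase_cons {α M : Type*} [DecidableEq α] [AddCommMonoid M]
    (F : α → Multiset α → M) (a : α) (s : Multiset α) :
    ((a ::ₘ s).map fun c => F c ((a ::ₘ s).erase c)).sum =
      F a s + (s.map fun c => F c (a ::ₘ s.erase c)).sum := by
  rw [map_cons, sum_cons, erase_cons_head]
  congr 2
  refine map_congr rfl fun c hc => ?_
  rw [erase_cons_tail_of_mem hc]

/-! ### Natural growth -/

namespace RTree

theorem growAux_graft (t : RTree) (s : Multiset RTree) :
    growAux t (graft s) = (fun s : Multiset (RTree × Multiset RTree) => by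
      classical exact (graft (s.map Prod.fst),
        graft (t ::ₘ s.map Prod.fst) ::ₘ
          s.bind fun c => c.2.map fun u => graft (u ::ₘ (s.erase c).map Prod.fst)))
        (s.map (growAux t)) := by
  unfold growAux
  rw [fold_graft]

theorem growAux_fst (t t' : RTree) : (growAux t t').1 = t' := by
  induction t' using RTree.induction with
  | h s ih =>
    rw [growAux_graft]
    simp only [Multiset.map_map, Function.comp_def]
    rw [Multiset.map_congr rfl ih, Multiset.map_id']

/-- The trees whose formal sum is `N_t(t')`. -/
noncomputable def growths (t t' : RTree) : Multiset RTree := (growAux t t').2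

-- The pairs in `growAux` only serve to remember the unmodified branches. Since the first component
-- returns the tree itself, `growAux t` is injective, so erasing a pair is the same as erasing its
-- tree.
open Classical in
theorem growths_graft (t : RTree) (s : Multiset RTree) :
    growths t (graft s) = graft (t ::ₘ s) ::ₘ
      s.bind fun c => (growths t c).map fun u => graft (u ::ₘ s.erase c) := by
  have hinj : Function.Injective (growAux t) := fun a b h => by
    rw [← growAux_fst t a, h, growAux_fst]
  have hs (s : Multiset RTree) : (s.map (growAux t)).map Prod.fst = s := by
    simp [Multiset.map_map, growAux_fst]
  rw [growths, growAux_graft]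
  simp only [hs, Multiset.bind_map]
  congr 2
  funext c
  refine Multiset.map_congr rfl fun u _ => ?_
  rw [← Multiset.map_erase _ hinj, hs]

theorem numVerts_graft (s : Multiset RTree) :
    numVerts (graft s) = (s.map numVerts).sum + 1 := fold_graft _ s

end RTree

/-- Removes the rational coefficients: from here on formal sums of grown trees are handled as sums
over multisets. -/
theorem linExt_grow {V : Type*} [AddCommGroup V] [Module ℝ V] (F : RTree → V) (t t' : RTree) :
    linExt F (RTree.grow t t') = ((RTree.growths t t').map F).sum := by
  let L : (RTree →₀ ℚ) →+ V := Finsupp.liftAddHom fun u =>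
    { toFun := fun c => (c : ℝ) • F u
      map_zero' := by simp
      map_add' := fun a b => by rw [Rat.cast_add, add_smul] }
  change L _ = _
  rw [RTree.grow, map_multiset_sum, Multiset.map_map]
  congr 1
  refine Multiset.map_congr rfl fun u _ => ?_
  simp [L]

/-! ### The contraction of derivatives with pairs of functions -/

section Contract

variable {W : Opens (ℝ × ℝ)} {f g h : ℝ × ℝ → ℝ} {p v : ℝ × ℝ}

theorem fderiv_apply_eq (h : ℝ × ℝ → ℝ) (p v : ℝ × ℝ) :
    fderiv ℝ h p v = v.1 * pdx h p + v.2 * pdz h p := by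
  have hv : v = v.1 • ((1 : ℝ), (0 : ℝ)) + v.2 • ((0 : ℝ), (1 : ℝ)) := by ext <;> simp
  conv_lhs => rw [hv]
  rw [map_add, map_smul, map_smul]
  rfl

theorem eqOn_pd (hfg : Set.EqOn f g W) (v : ℝ × ℝ) :
    Set.EqOn (fun p => fderiv ℝ f p v) (fun p => fderiv ℝ g p v) W := fun p hp => by
  have : f =ᶠ[nhds p] g := Filter.eventuallyEq_of_mem (W.isOpen.mem_nhds hp) hfg
  simp only [this.fderiv_eq]

theorem eqOn_iter (hfg : Set.EqOn f g W) (a b : ℕ) :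
    Set.EqOn (pdx^[a] (pdz^[b] f)) (pdx^[a] (pdz^[b] g)) W := by
  induction a with
  | zero =>
    induction b with
    | zero => exact hfg
    | succ b ih => simp only [Function.iterate_succ_apply'] at ih ⊢; exact eqOn_pd ih _
  | succ a ih => simp only [Function.iterate_succ_apply']; exact eqOn_pd ih _

theorem eqOn_contract (s : Multiset ((ℝ × ℝ → ℝ) × (ℝ × ℝ → ℝ))) (hfg : Set.EqOn f g W) :
    Set.EqOn (contract s f) (contract s g) W := fun p hp => by
  rw [contract_apply, contract_apply]
  simp only [eqOn_iter hfg _ _ hp]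

theorem differentiableAt_of_smooth (hh : ContDiffOn ℝ ∞ h W) (hp : p ∈ W) :
    DifferentiableAt ℝ h p :=
  (hh.contDiffAt (W.isOpen.mem_nhds hp)).differentiableAt (by simp)

theorem pdx_pdz_comm (hh : ContDiffOn ℝ ∞ h W) : Set.EqOn (pdx (pdz h)) (pdz (pdx h)) W := by
  intro p hp
  have hs : IsSymmSndFDerivAt ℝ h p :=
    (hh.contDiffAt (W.isOpen.mem_nhds hp)).isSymmSndFDerivAt (by
      rw [minSmoothness_of_isRCLikeNormedField]; exact WithTop.coe_le_coe.2 le_top)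
  have hd : DifferentiableAt ℝ (fderiv ℝ h) p :=
    ((hh.fderiv_of_isOpen W.isOpen (m := ∞) (by simp)).contDiffAt
      (W.isOpen.mem_nhds hp)).differentiableAt (by simp)
  have key (v w : ℝ × ℝ) :
      fderiv ℝ (fun q => fderiv ℝ h q v) p w = fderiv ℝ (fderiv ℝ h) p w v := by
    rw [fderiv_clm_apply hd (differentiableAt_const v)]
    simp
  change fderiv ℝ (fun q => fderiv ℝ h q _) p _ = fderiv ℝ (fun q => fderiv ℝ h q _) p _
  rw [key, key]
  exact hs _ _

theorem pdx_iter_pdz_comm (hh : ContDiffOn ℝ ∞ h W) (b : ℕ) :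
    Set.EqOn (pdx (pdz^[b] h)) (pdz^[b] (pdx h)) W := by
  induction b with
  | zero => exact fun _ _ => rfl
  | succ b ih =>
    simp only [Function.iterate_succ_apply']
    exact (pdx_pdz_comm (smooth_iter hh 0 b)).trans (eqOn_pd ih _)

theorem contract_zero (h : ℝ × ℝ → ℝ) : contract 0 h = h := by
  simp [contract]

/-- The sum splits according to the index carried by `a`. For index `x` the new `∂ₓ` must be moved
through all the `∂_z` to reach `h`, which uses the symmetry of second derivatives. -/
theorem contract_cons (a : (ℝ × ℝ → ℝ) × (ℝ × ℝ → ℝ))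
    (s : Multiset ((ℝ × ℝ → ℝ) × (ℝ × ℝ → ℝ))) (hh : ContDiffOn ℝ ∞ h W) (hp : p ∈ W) :
    contract (a ::ₘ s) h p = a.1 p * contract s (pdx h) p + a.2 p * contract s (pdz h) p := by
  have hx (n m : ℕ) : (pdx^[n + 1] (pdz^[m] h)) p = (pdx^[n] (pdz^[m] (pdx h))) p := by
    rw [Function.iterate_succ_apply]
    exact eqOn_iter (pdx_iter_pdz_comm hh m) n 0 hp
  simp only [contract_apply, Multiset.antidiagonal_cons, Multiset.map_add, Multiset.sum_add,
    Multiset.map_map, ← Multiset.sum_map_mul_left]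
  -- `Multiset.antidiagonal_cons` lists the splittings with `a` in the second part first.
  rw [add_comm]
  congr 2 <;> refine Multiset.map_congr rfl fun q _ => ?_
  · simp [hx, mul_assoc]
  · simp [Function.iterate_succ_apply, mul_assoc, mul_left_comm]

open Classical in
/-- The Leibniz rule for contractions. -/
theorem fderiv_contract (s : Multiset ((ℝ × ℝ → ℝ) × (ℝ × ℝ → ℝ)))
    (hs : ∀ a ∈ s, ContDiffOn ℝ ∞ a.1 W ∧ ContDiffOn ℝ ∞ a.2 W) (hh : ContDiffOn ℝ ∞ h W)
    (hp : p ∈ W) (v : ℝ × ℝ) :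
    fderiv ℝ (contract s h) p v =
      v.1 * contract s (pdx h) p + v.2 * contract s (pdz h) p +
        (s.map fun c => fderiv ℝ c.1 p v * contract (s.erase c) (pdx h) p +
          fderiv ℝ c.2 p v * contract (s.erase c) (pdz h) p).sum := by
  induction s using Multiset.induction generalizing h with
  | empty => simp [contract_zero, fderiv_apply_eq h p v]
  | cons a s ih =>
    have ha := hs a (Multiset.mem_cons_self a s)
    have hs' : ∀ a ∈ s, ContDiffOn ℝ ∞ a.1 W ∧ ContDiffOn ℝ ∞ a.2 W :=
      fun b hb => hs b (Multiset.mem_cons_of_mem hb)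
    have hx : ContDiffOn ℝ ∞ (pdx h) W := smooth_pd hh _
    have hz : ContDiffOn ℝ ∞ (pdz h) W := smooth_pd hh _
    -- Mixed derivatives are put in one order so that the final `ring` can match them.
    have hxz := fun u : Multiset _ => eqOn_contract u (pdx_pdz_comm hh) hp
    have hc : contract (a ::ₘ s) h =ᶠ[nhds p]
        a.1 * contract s (pdx h) + a.2 * contract s (pdz h) :=
      Filter.eventuallyEq_of_mem (W.isOpen.mem_nhds hp) fun q hq => contract_cons a s hh hq
    have d1 := differentiableAt_of_smooth ha.1 hp
    have d2 := differentiableAt_of_smooth ha.2 hp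
    have d3 := differentiableAt_of_smooth (smooth_contract hs' hx) hp
    have d4 := differentiableAt_of_smooth (smooth_contract hs' hz) hp
    rw [sum_map_erase_cons fun c u => fderiv ℝ c.1 p v * contract u (pdx h) p +
          fderiv ℝ c.2 p v * contract u (pdz h) p, hc.fderiv_eq,
      fderiv_add (d1.mul d3) (d2.mul d4), fderiv_mul d1 d3, fderiv_mul d2 d4]
    simp only [contract_cons a _ hx hp, contract_cons a _ hz hp, hxz, add_apply, smul_apply,
      ih hs' hx, ih hs' hz, smul_eq_mul]
    -- When a factor `c` of `s` is differentiated, `a` is still contracted; sorting by the index of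
    -- `a` recovers the sums in the induction hypotheses for `pdx h` and `pdz h`.
    have hsum : (s.map fun c =>
        fderiv ℝ c.1 p v * (a.1 p * contract (s.erase c) (pdx (pdx h)) p +
            a.2 p * contract (s.erase c) (pdz (pdx h)) p) +
          fderiv ℝ c.2 p v * (a.1 p * contract (s.erase c) (pdz (pdx h)) p +
            a.2 p * contract (s.erase c) (pdz (pdz h)) p)).sum =
        a.1 p * (s.map fun c => fderiv ℝ c.1 p v * contract (s.erase c) (pdx (pdx h)) p +
          fderiv ℝ c.2 p v * contract (s.erase c) (pdz (pdx h)) p).sum +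
        a.2 p * (s.map fun c => fderiv ℝ c.1 p v * contract (s.erase c) (pdz (pdx h)) p +
          fderiv ℝ c.2 p v * contract (s.erase c) (pdz (pdz h)) p).sum := by
      rw [← Multiset.sum_map_mul_left, ← Multiset.sum_map_mul_left, ← Multiset.sum_map_add]
      congr 1
      refine Multiset.map_congr rfl fun c _ => ?_
      ring
    rw [hsum]
    ring

end Contract

end ConnesMoscovici
namespace ConnesMoscovici

/-! ### Action of `X_t` and `∂_z` on `φ_{t'}(h)` -/

section Growth

variable {U : Opens ℝ} {W : Opens (ℝ × ℝ)} {h : ℝ × ℝ → ℝ} {p : ℝ × ℝ}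

theorem phiOp_graft (Γ : Christoffel U) (s : Multiset RTree) (h : ℝ × ℝ → ℝ) :
    phiOp Γ (RTree.graft s) h = contract (s.map (phi Γ)) h := by
  rw [phiOp, RTree.branches_graft]

/-- The coefficients are themselves values of the operator `φ_t`, so results proved for every `h`
apply to the coefficients of the branches inside an induction. -/
theorem phi_eq (Γ : Christoffel U) (t : RTree) :
    phi Γ t = (phiOp Γ t (phiBullet Γ).1, phiOp Γ t (phiBullet Γ).2) := by
  rw [← RTree.graft_branches t, phiOp_graft, phiOp_graft]
  exact RTree.fold_graft _ _

theorem smooth_map_phi (Γ : Christoffel U) (hW : (W : Set (ℝ × ℝ)) ⊆ frames U)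
    (s : Multiset RTree) :
    ∀ a ∈ s.map (phi Γ), ContDiffOn ℝ ∞ a.1 W ∧ ContDiffOn ℝ ∞ a.2 W := by
  intro a ha
  obtain ⟨u, -, rfl⟩ := Multiset.mem_map.1 ha
  exact ⟨(smooth_phi Γ u).1.mono hW, (smooth_phi Γ u).2.mono hW⟩

open Classical in
/-- The Leibniz rule for the operator `φ_t`. -/
theorem fderiv_phiOp_graft (Γ : Christoffel U) (hW : (W : Set (ℝ × ℝ)) ⊆ frames U)
    (hh : ContDiffOn ℝ ∞ h W) (hp : p ∈ W) (s : Multiset RTree) (v : ℝ × ℝ) :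
    fderiv ℝ (phiOp Γ (RTree.graft s) h) p v =
      v.1 * phiOp Γ (RTree.graft s) (pdx h) p + v.2 * phiOp Γ (RTree.graft s) (pdz h) p +
        (s.map fun c => fderiv ℝ (phi Γ c).1 p v * phiOp Γ (RTree.graft (s.erase c)) (pdx h) p +
          fderiv ℝ (phi Γ c).2 p v * phiOp Γ (RTree.graft (s.erase c)) (pdz h) p).sum := by
  simp only [phiOp_graft]
  rw [fderiv_contract _ (smooth_map_phi Γ hW s) hh hp, Multiset.map_map]
  congr 2
  refine Multiset.map_congr rfl fun c hc => ?_
  simp only [Function.comp_apply, Multiset.map_erase_of_mem _ _ hc]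

theorem phiOp_graft_cons (Γ : Christoffel U) (hh : ContDiffOn ℝ ∞ h W) (hp : p ∈ W) (t : RTree)
    (s : Multiset RTree) :
    phiOp Γ (RTree.graft (t ::ₘ s)) h p =
      (phi Γ t).1 p * phiOp Γ (RTree.graft s) (pdx h) p +
        (phi Γ t).2 p * phiOp Γ (RTree.graft s) (pdz h) p := by
  simp only [phiOp_graft, Multiset.map_cons]
  exact contract_cons _ _ hh hp

theorem phiOp_graft_singleton (Γ : Christoffel U) (hh : ContDiffOn ℝ ∞ h W) (hp : p ∈ W)
    (t : RTree) :
    phiOp Γ (RTree.graft {t}) h p = (phi Γ t).1 p * pdx h p + (phi Γ t).2 p * pdz h p := by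
  rw [← Multiset.cons_zero, phiOp_graft_cons Γ hh hp]
  simp [phiOp_graft, contract_zero]

/-- The vector field `X_t` maps `φ_{t'}(h)` to `φ_{N_t(t')}(h)`. -/
theorem fderiv_phiOp_phi (Γ : Christoffel U) (hW : (W : Set (ℝ × ℝ)) ⊆ frames U)
    (hh : ContDiffOn ℝ ∞ h W) (hp : p ∈ W) (t t' : RTree) :
    fderiv ℝ (phiOp Γ t' h) p ((phi Γ t).1 p, (phi Γ t).2 p) =
      ((RTree.growths t t').map fun u => phiOp Γ u h p).sum := by
  classical
  induction t' using RTree.induction generalizing h with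
  -- The function `h` is generalized because the branches are used with the components of `phiBullet
  -- Γ` in its place. The two leading Leibniz terms form the tree with `t` attached at the root.
  | h s ih =>
    rw [fderiv_phiOp_graft Γ hW hh hp, RTree.growths_graft, Multiset.map_cons, Multiset.sum_cons,
      phiOp_graft_cons Γ hh hp, Multiset.map_bind, Multiset.sum_bind]
    congr 2
    refine Multiset.map_congr rfl fun c hc => ?_
    have h1 := ih c hc ((smooth_phiBullet Γ).1.mono hW)
    have h2 := ih c hc ((smooth_phiBullet Γ).2.mono hW)
    simp only [Multiset.map_map, Function.comp_def, phiOp_graft_cons Γ hh hp,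
      Multiset.sum_map_add, Multiset.sum_map_mul_right]
    rw [phi_eq Γ c, h1, h2]
    simp only [phi_eq Γ]

/-- If `h` is homogeneous of degree `1`, then `φ_t(h)` is homogeneous of degree `|V(t)|`. -/
theorem pdz_phiOp (Γ : Christoffel U) (hW : (W : Set (ℝ × ℝ)) ⊆ frames U)
    (hb : Set.EqOn (pdz (phiBullet Γ).1) (phiBullet Γ).1 W ∧
      Set.EqOn (pdz (phiBullet Γ).2) (phiBullet Γ).2 W)
    (hh : ContDiffOn ℝ ∞ h W) (hz : Set.EqOn (pdz h) h W) (hp : p ∈ W) (t : RTree) :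
    pdz (phiOp Γ t h) p = t.numVerts * phiOp Γ t h p := by
  classical
  induction t using RTree.induction generalizing h with
  | h s ih =>
    rw [pdz, fderiv_phiOp_graft Γ hW hh hp, phiOp_graft, phiOp_graft, eqOn_contract _ hz hp,
      RTree.numVerts_graft]
    have key : ∀ c ∈ s,
        fderiv ℝ (phi Γ c).1 p (0, 1) * phiOp Γ (RTree.graft (s.erase c)) (pdx h) p +
          fderiv ℝ (phi Γ c).2 p (0, 1) * phiOp Γ (RTree.graft (s.erase c)) (pdz h) p =
        c.numVerts * contract (s.map (phi Γ)) h p := by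
      intro c hc
      have h1 := ih c hc ((smooth_phiBullet Γ).1.mono hW) hb.1
      have h2 := ih c hc ((smooth_phiBullet Γ).2.mono hW) hb.2
      -- Once the degree of `c` is factored out, putting `c` back restores the full contraction; the
      -- remaining `+ 1` is the degree of `h`.
      have h3 := phiOp_graft_cons Γ hh hp c (s.erase c)
      rw [Multiset.cons_erase hc, phiOp_graft] at h3
      rw [pdz] at h1 h2
      rw [h3, phi_eq Γ c, h1, h2]
      ring
    rw [Multiset.map_congr rfl key, Multiset.sum_map_mul_right, Nat.cast_add,
      Nat.cast_multiset_sum, Multiset.map_map]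
    simp only [Function.comp_def, Nat.cast_one, phiOp_graft]
    ring

/-- On a vertical line `A` is constant, so no regularity of `A` is needed. -/
theorem pdz_eq_self (A : ℝ → ℝ) (hh : ContDiffOn ℝ ∞ h W)
    (hA : ∀ p : ℝ × ℝ, p ∈ W → h p = Real.exp p.2 * A p.1) :
    Set.EqOn (pdz h) h W := by
  intro p hp
  have hc : HasDerivAt (fun z : ℝ => (p.1, z)) (0, 1) p.2 :=
    (hasDerivAt_const p.2 p.1).prodMk (hasDerivAt_id p.2)
  have h1 : HasDerivAt (fun z => h (p.1, z)) (pdz h p) p.2 :=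
    (differentiableAt_of_smooth hh hp).hasFDerivAt.comp_hasDerivAt p.2 hc
  have h2 : HasDerivAt (fun z => h (p.1, z)) (Real.exp p.2 * A p.1) p.2 := by
    refine ((Real.hasDerivAt_exp p.2).mul_const (A p.1)).congr_of_eventuallyEq ?_
    filter_upwards [hc.continuousAt.preimage_mem_nhds (W.isOpen.mem_nhds hp)] with z hz
    exact hA _ hz
  rw [h1.unique h2, hA p hp]

theorem pdz_phiBullet (Γ : Christoffel U) :
    Set.EqOn (pdz (phiBullet Γ).1) (phiBullet Γ).1 (frames U) ∧
      Set.EqOn (pdz (phiBullet Γ).2) (phiBullet Γ).2 (frames U) :=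
  ⟨pdz_eq_self (fun _ => 1) (smooth_phiBullet Γ).1 fun p _ => by simp [phiBullet],
    pdz_eq_self (fun x => -Γ.toFun x) (smooth_phiBullet Γ).2 fun p _ => by simp [phiBullet]⟩

/-- Explicitly, `γ_•(ψ) = e^z ((log ψ')' - Γ + ψ' · (Γ ∘ ψ))`; the factor `ψ'` arises from `e^{z +
log ψ'}` in `φᶻ(•) ∘ ψ̃`. -/
theorem pdz_gammaBullet (Γ : Christoffel U) (ψ : LocDiff U) :
    Set.EqOn (pdz (gammaBullet Γ ψ)) (gammaBullet Γ ψ) (frames ψ.dom) := by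
  refine pdz_eq_self (fun x => deriv (fun x => Real.log (deriv ψ.toFun x)) x - Γ.toFun x +
    deriv ψ.toFun x * Γ.toFun (ψ.toFun x)) (smooth_gammaBullet Γ ψ) fun p hp => ?_
  have hd : ContDiffOn ℝ ∞ (fun x => Real.log (deriv ψ.toFun x)) ψ.dom :=
    (ψ.contDiffOn.deriv_of_isOpen ψ.dom.isOpen (by simp)).log
      fun x hx => (ψ.deriv_pos x hx).ne'
  have hl : HasDerivAt (fun x => Real.log (deriv ψ.toFun x)) _ p.1 :=
    ((hd.contDiffAt (ψ.dom.isOpen.mem_nhds hp)).differentiableAt (by simp)).hasDerivAt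
  have hf : HasFDerivAt (fun q : ℝ × ℝ => (ψ.lift q).2) _ p :=
    (hasFDerivAt_snd (p := p)).add (hl.comp_hasFDerivAt (f := Prod.fst) (f' := ContinuousLinearMap.fst ℝ ℝ ℝ) p hasFDerivAt_fst)
  simp only [gammaBullet, pdx, pdz, hf.fderiv]
  simp [phiBullet, LocDiff.lift, Real.exp_add, Real.exp_log (ψ.deriv_pos p.1 hp)]
  ring

theorem pdz_phi (Γ : Christoffel U) (t : RTree) (hp : p ∈ frames U) :
    pdz (phi Γ t).1 p = t.numVerts * (phi Γ t).1 p ∧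
      pdz (phi Γ t).2 p = t.numVerts * (phi Γ t).2 p := by
  rw [phi_eq]
  exact ⟨pdz_phiOp Γ subset_rfl (pdz_phiBullet Γ) (smooth_phiBullet Γ).1 (pdz_phiBullet Γ).1 hp t,
    pdz_phiOp Γ subset_rfl (pdz_phiBullet Γ) (smooth_phiBullet Γ).2 (pdz_phiBullet Γ).2 hp t⟩

theorem pdz_gamma (Γ : Christoffel U) (t : RTree) (ψ : LocDiff U) (hp : p ∈ frames ψ.dom) :
    pdz (gamma Γ t ψ) p = t.numVerts * gamma Γ t ψ p :=
  pdz_phiOp Γ (frames_mono ψ.dom_le)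
    ⟨(pdz_phiBullet Γ).1.mono (frames_mono ψ.dom_le),
      (pdz_phiBullet Γ).2.mono (frames_mono ψ.dom_le)⟩
    (smooth_gammaBullet Γ ψ) (pdz_gammaBullet Γ ψ) hp t

end Growth

end ConnesMoscovici
namespace ConnesMoscovici

/-! ### Commutators on `C_c^∞(W)` -/

section CompactSupport

variable {U : Opens ℝ} {W : Opens (ℝ × ℝ)}

/-- Test functions vanish off `W`, so the values of the coefficients there play no role. -/
theorem Cc.ext_on {f g : Cc W} (h : ∀ p ∈ W, f p = g p) : f = g := by
  refine DFunLike.coe_injective (funext fun p => ?_)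
  by_cases hp : p ∈ W
  · exact h p hp
  · rw [image_eq_zero_of_notMem_tsupport fun hq => hp (f.tsupport_subset hq),
      image_eq_zero_of_notMem_tsupport fun hq => hp (g.tsupport_subset hq)]

theorem Cc.differentiable (f : Cc W) : Differentiable ℝ f :=
  f.contDiff.differentiable (by simp)

theorem Cc.sum_end_apply (s : Multiset (Module.End ℝ (Cc W))) (f : Cc W) (p : ℝ × ℝ) :
    s.sum f p = (s.map fun A => A f p).sum := by
  induction s using Multiset.induction with
  | empty => rfl
  | cons A s ih =>
    rw [Multiset.sum_cons, Multiset.map_cons, Multiset.sum_cons, ← ih]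
    rfl

theorem coe_mulCc {g : ℝ × ℝ → ℝ} (hg : ContDiffOn ℝ ∞ g W) (f : Cc W) :
    (mulCc g hg f : ℝ × ℝ → ℝ) = g * f := rfl

theorem coe_dzCc (f : Cc W) : (dzCc f : ℝ × ℝ → ℝ) = pdz f := rfl

/-- The vector field `X_t` on `C_c^∞(W)`, for `W` contained in the frame bundle of `U`. -/
noncomputable def vecCc (Γ : Christoffel U) (t : RTree) (hW : (W : Set (ℝ × ℝ)) ⊆ frames U) :
    Module.End ℝ (Cc W) :=
  mulCc (phi Γ t).1 ((smooth_phi Γ t).1.mono hW) * dxCc +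
    mulCc (phi Γ t).2 ((smooth_phi Γ t).2.mono hW) * dzCc

theorem coe_vecCc (Γ : Christoffel U) (t : RTree) (hW : (W : Set (ℝ × ℝ)) ⊆ frames U) (f : Cc W) :
    (vecCc Γ t hW f : ℝ × ℝ → ℝ) = (phi Γ t).1 * pdx f + (phi Γ t).2 * pdz f := rfl

theorem vecCc_apply (Γ : Christoffel U) (t : RTree) (hW : (W : Set (ℝ × ℝ)) ⊆ frames U)
    (f : Cc W) (p : ℝ × ℝ) :
    vecCc Γ t hW f p = fderiv ℝ f p ((phi Γ t).1 p, (phi Γ t).2 p) := by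
  rw [fderiv_apply_eq]
  rfl

theorem fderiv_vecCc (Γ : Christoffel U) (t : RTree) (hW : (W : Set (ℝ × ℝ)) ⊆ frames U)
    (f : Cc W) {p : ℝ × ℝ} (hp : p ∈ W) (v : ℝ × ℝ) :
    fderiv ℝ (vecCc Γ t hW f) p v =
      fderiv ℝ (phi Γ t).1 p v * pdx f p + fderiv ℝ (phi Γ t).2 p v * pdz f p +
        ((phi Γ t).1 p * fderiv ℝ (pdx f) p v + (phi Γ t).2 p * fderiv ℝ (pdz f) p v) := by
  have d1 := differentiableAt_of_smooth ((smooth_phi Γ t).1.mono hW) hp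
  have d2 := differentiableAt_of_smooth ((smooth_phi Γ t).2.mono hW) hp
  have d3 : DifferentiableAt ℝ (pdx f) p := differentiableAt_of_smooth (smooth_pd f.smoothOn _) hp
  have d4 : DifferentiableAt ℝ (pdz f) p := differentiableAt_of_smooth (smooth_pd f.smoothOn _) hp
  rw [coe_vecCc, fderiv_add (d1.mul d3) (d2.mul d4), fderiv_mul d1 d3, fderiv_mul d2 d4]
  simp only [add_apply, smul_apply, smul_eq_mul]
  ring

/-- The second derivatives of `f` cancel by symmetry, leaving `∂_z` of the coefficients, which are
homogeneous of degree `|V(t)|`. -/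
theorem lie_dzCc_vecCc (Γ : Christoffel U) (t : RTree) (hW : (W : Set (ℝ × ℝ)) ⊆ frames U) :
    dzCc * vecCc Γ t hW - vecCc Γ t hW * dzCc = (t.numVerts : ℝ) • vecCc Γ t hW := by
  refine LinearMap.ext fun f => Cc.ext_on fun p hp => ?_
  change fderiv ℝ (vecCc Γ t hW f) p (0, 1) - vecCc Γ t hW (dzCc f) p =
    (t.numVerts : ℝ) * vecCc Γ t hW f p
  rw [fderiv_vecCc Γ t hW f hp, coe_vecCc, coe_vecCc, coe_dzCc]
  have h1 := pdz_phi Γ t (hW hp)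
  have h2 : fderiv ℝ (pdx f) p (0, 1) = pdx (pdz f) p := (pdx_pdz_comm f.smoothOn hp).symm
  rw [pdz, pdz] at h1
  rw [h1.1, h1.2, h2]
  simp only [Pi.add_apply, Pi.mul_apply]
  change _ + (_ + (phi Γ t).2 p * pdz (pdz f) p) - _ = _
  ring

theorem lie_dzCc_mulCc {g : ℝ × ℝ → ℝ} (hg : ContDiffOn ℝ ∞ g W) (c : ℝ)
    (hc : ∀ p ∈ W, pdz g p = c * g p) :
    dzCc * mulCc g hg - mulCc g hg * dzCc = c • mulCc g hg := by
  refine LinearMap.ext fun f => Cc.ext_on fun p hp => ?_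
  change fderiv ℝ (g * (f : ℝ × ℝ → ℝ)) p (0, 1) - g p * fderiv ℝ f p (0, 1) = c * (g p * f p)
  rw [fderiv_mul (differentiableAt_of_smooth hg hp) (f.differentiable p)]
  have := hc p hp
  rw [pdz] at this
  simp only [add_apply, smul_apply, smul_eq_mul, this]
  ring

/-- A vector field is a derivation, so its commutator with multiplication by `g` is multiplication
by the derivative of `g`. -/
theorem lie_vecCc_mulCc (Γ : Christoffel U) (t : RTree) (hW : (W : Set (ℝ × ℝ)) ⊆ frames U)
    {g : ℝ × ℝ → ℝ} (hg : ContDiffOn ℝ ∞ g W) (f : Cc W) {p : ℝ × ℝ} (hp : p ∈ W) :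
    (vecCc Γ t hW * mulCc g hg - mulCc g hg * vecCc Γ t hW) f p =
      fderiv ℝ g p ((phi Γ t).1 p, (phi Γ t).2 p) * f p := by
  change vecCc Γ t hW (mulCc g hg f) p - g p * vecCc Γ t hW f p = _
  rw [vecCc_apply, vecCc_apply, coe_mulCc,
    fderiv_mul (differentiableAt_of_smooth hg hp) (f.differentiable p)]
  simp only [add_apply, smul_apply, smul_eq_mul]
  ring

theorem lie_vecCc_vecCc (Γ : Christoffel U) (t t' : RTree) (hW : (W : Set (ℝ × ℝ)) ⊆ frames U) :
    vecCc Γ t hW * vecCc Γ t' hW - vecCc Γ t' hW * vecCc Γ t hW =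
      ((RTree.growths t t').map fun u => vecCc Γ u hW).sum -
        ((RTree.growths t' t).map fun u => vecCc Γ u hW).sum := by
  refine LinearMap.ext fun f => Cc.ext_on fun p hp => ?_
  -- The vector field of `N_t(t')` has coefficients `X_t(φⁱ(t'))`, exactly the first-order terms of
  -- `X_t X_{t'}`.
  have key (t t' : RTree) : ((RTree.growths t t').map fun u => vecCc Γ u hW).sum f p =
      fderiv ℝ (phi Γ t').1 p ((phi Γ t).1 p, (phi Γ t).2 p) * pdx f p +
        fderiv ℝ (phi Γ t').2 p ((phi Γ t).1 p, (phi Γ t).2 p) * pdz f p := by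
    rw [Cc.sum_end_apply, Multiset.map_map, phi_eq Γ t',
      fderiv_phiOp_phi Γ hW ((smooth_phiBullet Γ).1.mono hW) hp,
      fderiv_phiOp_phi Γ hW ((smooth_phiBullet Γ).2.mono hW) hp,
      ← Multiset.sum_map_mul_right, ← Multiset.sum_map_mul_right, ← Multiset.sum_map_add]
    congr 1
    refine Multiset.map_congr rfl fun u _ => ?_
    rw [Function.comp_apply, coe_vecCc, phi_eq Γ u]
    rfl
  change vecCc Γ t hW (vecCc Γ t' hW f) p - vecCc Γ t' hW (vecCc Γ t hW f) p =
    ((RTree.growths t t').map fun u => vecCc Γ u hW).sum f p -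
      ((RTree.growths t' t).map fun u => vecCc Γ u hW).sum f p
  rw [key, key, vecCc_apply, vecCc_apply, fderiv_vecCc Γ _ hW f hp, fderiv_vecCc Γ _ hW f hp]
  simp only [fderiv_apply_eq (pdx f), fderiv_apply_eq (pdz f), ← pdx_pdz_comm f.smoothOn hp]
  ring

theorem phiCc_graft_singleton (Γ : Christoffel U) (t : RTree)
    (hW : (W : Set (ℝ × ℝ)) ⊆ frames U) : phiCc Γ (RTree.graft {t}) hW = vecCc Γ t hW :=
  LinearMap.ext fun f => Cc.ext_on fun _ hp => phiOp_graft_singleton Γ f.smoothOn hp t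

end CompactSupport

/-! ### Passage to the crossed product -/

section Operators

variable {U : Opens ℝ}

/-- The operator on the crossed product with given components, as an additive map. -/
noncomputable def diagOp (U : Opens ℝ) :
    (∀ ψ : LocDiff U, Module.End ℝ (Cc (frames ψ.dom))) →+ Module.End ℝ (CrossedProduct U) where
  toFun A := DirectSum.lmap A
  map_zero' := by
    classical
    refine DirectSum.linearMap_ext ℝ fun ψ => LinearMap.ext fun f => ?_
    change DirectSum.lmap (0 : ∀ ψ : LocDiff U, Module.End ℝ (Cc (frames ψ.dom))) _ = 0
    simp
  map_add' A B := by
    classical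
    refine DirectSum.linearMap_ext ℝ fun ψ => LinearMap.ext fun f => ?_
    change DirectSum.lmap (A + B) _ = DirectSum.lmap A _ + DirectSum.lmap B _
    simp

theorem diagOp_mul (A B : ∀ ψ : LocDiff U, Module.End ℝ (Cc (frames ψ.dom))) :
    diagOp U (A * B) = diagOp U A * diagOp U B := by
  classical
  refine DirectSum.linearMap_ext ℝ fun ψ => LinearMap.ext fun f => ?_
  change DirectSum.lmap (A * B) _ = DirectSum.lmap A (DirectSum.lmap B _)
  simp

theorem diagOp_smul (c : ℝ) (A : ∀ ψ : LocDiff U, Module.End ℝ (Cc (frames ψ.dom))) :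
    diagOp U (c • A) = c • diagOp U A := by
  classical
  refine DirectSum.linearMap_ext ℝ fun ψ => LinearMap.ext fun f => ?_
  change DirectSum.lmap (c • A) _ = c • DirectSum.lmap A _
  simp

theorem lie_diagOp (A B : ∀ ψ : LocDiff U, Module.End ℝ (Cc (frames ψ.dom))) :
    ⁅diagOp U A, diagOp U B⁆ = diagOp U (A * B - B * A) := by
  rw [map_sub, diagOp_mul, diagOp_mul]
  rfl

theorem sum_map_diagOp {ι : Type*} (s : Multiset ι)
    (A : ι → ∀ ψ : LocDiff U, Module.End ℝ (Cc (frames ψ.dom))) :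
    (s.map fun i => diagOp U (A i)).sum = diagOp U fun ψ => (s.map fun i => A i ψ).sum := by
  have h := map_multiset_sum (diagOp U) (s.map A)
  rw [Multiset.map_map] at h
  refine h.symm.trans (congrArg _ (funext fun ψ => ?_))
  have h := map_multiset_sum (Pi.evalAddMonoidHom
    (fun ψ : LocDiff U => Module.End ℝ (Cc (frames ψ.dom))) ψ) (s.map A)
  rwa [Multiset.map_map] at h

theorem opY_eq : opY U = diagOp U fun _ => dzCc := rfl

theorem opX_eq (Γ : Christoffel U) (t : RTree) :
    opX Γ t = diagOp U fun ψ => vecCc Γ t (frames_mono ψ.dom_le) := rfl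

theorem opDelta_eq (Γ : Christoffel U) (t : RTree) :
    opDelta Γ t = diagOp U fun ψ => mulCc (gamma Γ t ψ) (smooth_gamma Γ t ψ) := rfl

theorem opPhi_eq (Γ : Christoffel U) (t : RTree) :
    opPhi Γ t = diagOp U fun ψ => phiCc Γ t (frames_mono ψ.dom_le) := rfl

theorem lie_opY_opX (Γ : Christoffel U) (t : RTree) :
    ⁅opY U, opX Γ t⁆ = (t.numVerts : ℝ) • opX Γ t := by
  rw [opY_eq, opX_eq, lie_diagOp, ← diagOp_smul]
  exact congrArg _ (funext fun ψ => lie_dzCc_vecCc Γ t (frames_mono ψ.dom_le))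

theorem lie_opY_opDelta (Γ : Christoffel U) (t : RTree) :
    ⁅opY U, opDelta Γ t⁆ = (t.numVerts : ℝ) • opDelta Γ t := by
  rw [opY_eq, opDelta_eq, lie_diagOp, ← diagOp_smul]
  exact congrArg _ (funext fun ψ =>
    lie_dzCc_mulCc (smooth_gamma Γ t ψ) _ fun p hp => pdz_gamma Γ t ψ hp)

/-- On each component the commutator is multiplication by `X_t(γ_{t'}(ψ))`, and `γ_{t'}(ψ) =
φ_{t'}(γ_•(ψ))` grows by `fderiv_phiOp_phi`. -/
theorem lie_opX_opDelta (Γ : Christoffel U) (t t' : RTree) :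
    ⁅opX Γ t, opDelta Γ t'⁆ = linExt (opDelta Γ) (RTree.grow t t') := by
  rw [linExt_grow, opX_eq, opDelta_eq, lie_diagOp]
  refine Eq.trans (congrArg _ (funext fun ψ => ?_)) (sum_map_diagOp (RTree.growths t t')
    fun u ψ => mulCc (gamma Γ u ψ) (smooth_gamma Γ u ψ)).symm
  refine LinearMap.ext fun f => Cc.ext_on fun p hp => ?_
  refine (lie_vecCc_mulCc Γ t (frames_mono ψ.dom_le) (smooth_gamma Γ t' ψ) f hp).trans ?_
  rw [gamma, fderiv_phiOp_phi Γ (frames_mono ψ.dom_le) (smooth_gammaBullet Γ ψ) hp,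
    Cc.sum_end_apply, Multiset.map_map, ← Multiset.sum_map_mul_right]
  rfl

theorem lie_opX_opX (Γ : Christoffel U) (t t' : RTree) :
    ⁅opX Γ t, opX Γ t'⁆ =
      linExt (opX Γ) (RTree.grow t t') - linExt (opX Γ) (RTree.grow t' t) := by
  have h (t t' : RTree) := sum_map_diagOp (RTree.growths t t')
    fun u (ψ : LocDiff U) => vecCc Γ u (frames_mono ψ.dom_le)
  rw [linExt_grow, linExt_grow]
  refine Eq.trans ?_ (congrArg₂ (· - ·) (h t t') (h t' t)).symm
  rw [opX_eq, opX_eq, lie_diagOp]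
  simp only [← map_sub]
  exact congrArg _ (funext fun ψ => lie_vecCc_vecCc Γ t t' (frames_mono ψ.dom_le))

theorem lie_opDelta_opDelta (Γ : Christoffel U) (t t' : RTree) :
    ⁅opDelta Γ t, opDelta Γ t'⁆ = 0 := by
  rw [opDelta_eq, opDelta_eq, lie_diagOp, ← map_zero (diagOp U)]
  refine congrArg _ (funext fun ψ => LinearMap.ext fun f => Cc.ext_on fun p _ => ?_)
  change gamma Γ t ψ p * (gamma Γ t' ψ p * f p) - gamma Γ t' ψ p * (gamma Γ t ψ p * f p) = 0
  ring

theorem opPhi_graft_singleton (Γ : Christoffel U) (t : RTree) :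
    opPhi Γ (RTree.graft {t}) = opX Γ t := by
  rw [opPhi_eq, opX_eq]
  exact congrArg _ (funext fun ψ => phiCc_graft_singleton Γ t _)

/-- Attaching `t` at the root of `B₊(t')` gives the first term; attaching it inside `t'` leaves a
single branch, and such trees act as vector fields. -/
theorem linExt_opPhi_grow_graft (Γ : Christoffel U) (t t' : RTree) :
    linExt (opPhi Γ) (RTree.grow t (RTree.graft {t'})) =
      opPhi Γ (RTree.graft {t, t'}) + linExt (opX Γ) (RTree.grow t t') := by
  classical
  rw [linExt_grow, linExt_grow, RTree.growths_graft, Multiset.map_cons, Multiset.sum_cons,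
    Multiset.singleton_bind, Multiset.erase_singleton, Multiset.map_map]
  simp only [Function.comp_def, Multiset.cons_zero, opPhi_graft_singleton]
  rfl

theorem coe_linExt {Γ : Christoffel U} (F : RTree → L1 Γ) (v : RTree →₀ ℚ) :
    ((linExt F v : L1 Γ) : Module.End ℝ (CrossedProduct U)) =
      linExt (fun u => (F u : Module.End ℝ (CrossedProduct U))) v :=
  map_finsuppSum (L1 Γ).toSubmodule.subtype v fun u c => (c : ℝ) • F u

end Operators

end ConnesMoscovici

theorem mainTheorem7 (U : TopologicalSpace.Opens ℝ) (Γ : Christoffel U) (t t' : RTree) :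
    ⁅L1.Y Γ, L1.X Γ t⁆ = (t.numVerts : ℝ) • L1.X Γ t ∧
    ⁅L1.X Γ t, L1.δ Γ t'⁆ = linExt (L1.δ Γ) (RTree.grow t t') ∧
    ⁅L1.Y Γ, L1.δ Γ t⁆ = (t.numVerts : ℝ) • L1.δ Γ t ∧
    ⁅L1.X Γ t, L1.X Γ t'⁆ =
      linExt (L1.X Γ) (RTree.grow t t') - linExt (L1.X Γ) (RTree.grow t' t) ∧
    ((⁅L1.X Γ t, L1.X Γ t'⁆ : L1 Γ) : Module.End ℝ (CrossedProduct U)) =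
      linExt (opPhi Γ) (RTree.grow t (RTree.graft {t'})) -
        linExt (opPhi Γ) (RTree.grow t' (RTree.graft {t})) ∧
    ⁅L1.δ Γ t, L1.δ Γ t'⁆ = 0 := by
  have hX : ((⁅L1.X Γ t, L1.X Γ t'⁆ : L1 Γ) : Module.End ℝ (CrossedProduct U)) =
      linExt (opX Γ) (RTree.grow t t') - linExt (opX Γ) (RTree.grow t' t) := by
    rw [LieSubalgebra.coe_bracket]
    exact lie_opX_opX Γ t t'
  refine ⟨?_, ?_, ?_, ?_, ?_, ?_⟩
  · refine Subtype.ext ?_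
    rw [LieSubalgebra.coe_bracket, SetLike.val_smul]
    exact lie_opY_opX Γ t
  · refine Subtype.ext ?_
    rw [LieSubalgebra.coe_bracket, coe_linExt (L1.δ Γ)]
    exact lie_opX_opDelta Γ t t'
  · refine Subtype.ext ?_
    rw [LieSubalgebra.coe_bracket, SetLike.val_smul]
    exact lie_opY_opDelta Γ t
  · refine Subtype.ext ?_
    rw [hX, AddSubgroupClass.coe_sub, coe_linExt (L1.X Γ), coe_linExt (L1.X Γ)]
    rfl
  -- Forests are unordered, so both expansions contain the same tree `B₊(t t')`, which cancels.
  · rw [hX, linExt_opPhi_grow_graft, linExt_opPhi_grow_graft, Multiset.pair_comm t' t,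
      add_sub_add_left_eq_sub]
  · refine Subtype.ext ?_
    rw [LieSubalgebra.coe_bracket]
    exact lie_opDelta_opDelta Γ t t'
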